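/- All objects are smooth, manifolds are Hausdorff and finite-dimensional without boundary. An almost CR structure of codimension $d$ on an $m$-dimensional manifold $M$ is a pair $(HM,J)$ where $HM\subseteq TM$ is a smooth real subbundle of rank $m-d$ and $J:HM\to HM$ is a smooth bundle endomorphism with $J^2=-\mathrm{id}$. A smooth map $f:M\to N$ between manifolds with almost CR structures $(HM,J)$, $(HN,J^N)$ is an almost CR map if $df(HM)\subseteq HN$ and $df\circ J=J^N\circ df$ on $HM$. **Proposition.** Let $(HM,J)$ be an almost CR structure of codimension $d$ on $M$, let $p:E\to M$ be a complex vector bundle of finite rank (a smooth real vector bundle whose fibres are complex vector spaces, with fibrewise complex linear local trivializations), and let $\nabla$ be a (real) linear connection on $E$, that is, $\nabla:\Gamma(M,E)\to\Gamma(M,T^*M\otimes E)$ is additive and $\nabla(fs)=f\nabla s+df\otimes s$; it need not be compatible with the complex structure of $E$. For $v\in E$ with $p(v)=x$ let $(VE)_v=\ker dp_v$, which is identified with $E_x$ by the vertical lift $u\mapsto u^{\mathrm v}_v=\frac{d}{dt}\big|_{t=0}(v+tu)$, and let $(\tilde HE)_v\subseteq T_vE$ be the horizontal space of $\nabla$,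 the span of all $ds_x(X)$ with $X\in T_xM$ and $s$ a smooth section of $E$ with $s(x)=v$ and $(\nabla s)(x)=0$. Then $T_vE=(\tilde HE)_v\oplus(VE)_v$ for every $v\in E$, and there is an almost CR structure $(HE,J_E)$ on the total space $E$, of the same codimension $d$, such that: 1. $p:E\to M$ is an almost CR map; 2. $(HE)_v=\{w\in(\tilde HE)_v : dp(w)\in HM\}\oplus(VE)_v$ for every $v\in E$; 3. if $w\in(\tilde HE)_v$ and $dp(w)\in HM$, then $J_Ew\in(\tilde HE)_v$ and $dp(J_Ew)=J(dp(w))$; 4. $J_E(u^{\mathrm v}_v)=(iu)^{\mathrm v}_v$ for every $v\in E$ and $u\in E_{p(v)}$. -/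

import Mathlib

open Bundle Module
open scoped Manifold ContDiff

noncomputable section

section AlmostCR

variable {E : Type*} [NormedAddCommGroup E] [NormedSpace ℝ E] [FiniteDimensional ℝ E]
  {H : Type*} [TopologicalSpace H] (I : ModelWithCorners ℝ E H)
  (M : Type*) [TopologicalSpace M] [ChartedSpace H M] [IsManifold I ∞ M]

/-- An almost CR structure of codimension `d` on a finite-dimensional smooth manifold `M`:
a smooth subbundle `HM` of `TM` of corank `d` (the Levi distribution) together with a smooth
bundle endomorphism `J` of `HM` such that `J² = -id`. -/
structure AlmostCRStructure (d : ℕ) where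
  /-- The Levi distribution `HM`. -/
  levi : ∀ x : M, Submodule ℝ (TangentSpace I x)
  /-- The codimension of the Levi distribution is `d` at every point. -/
  finrank_levi_add : ∀ x : M, finrank ℝ (levi x) + d = finrank ℝ (TangentSpace I x)
  /-- `HM` is a smooth subbundle: it has a smooth local frame around every point. -/
  exists_local_frame : ∀ x₀ : M, ∃ U : Set M, IsOpen U ∧ x₀ ∈ U ∧
    ∃ (r : ℕ) (X : Fin r → ∀ x : M, TangentSpace I x),
      (∀ i, ContMDiffOn I I.tangent ∞ (fun x ↦ (⟨x, X i x⟩ : TangentBundle I M)) U) ∧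
      ∀ x ∈ U, LinearIndependent ℝ (fun i ↦ X i x) ∧
        Submodule.span ℝ (Set.range fun i ↦ X i x) = levi x
  /-- The endomorphism `J` of `HM`. -/
  J : ∀ x : M, levi x →ₗ[ℝ] levi x
  /-- `J² = -id`. -/
  J_J : ∀ (x : M) (v : levi x), J x (J x v) = -v
  /-- `J` is smooth: it maps smooth local sections of `HM` to smooth local sections. -/
  contMDiffOn_J : ∀ (U : Set M), IsOpen U → ∀ X : ∀ x : M, levi x,
    ContMDiffOn I I.tangent ∞ (fun x ↦ (⟨x, (X x : TangentSpace I x)⟩ : TangentBundle I M)) U →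
    ContMDiffOn I I.tangent ∞
      (fun x ↦ (⟨x, (J x (X x) : TangentSpace I x)⟩ : TangentBundle I M)) U

end AlmostCR

section AlmostCRMap

variable {E : Type*} [NormedAddCommGroup E] [NormedSpace ℝ E] [FiniteDimensional ℝ E]
  {H : Type*} [TopologicalSpace H] {I : ModelWithCorners ℝ E H}
  {M : Type*} [TopologicalSpace M] [ChartedSpace H M] [IsManifold I ∞ M]
  {E' : Type*} [NormedAddCommGroup E'] [NormedSpace ℝ E'] [FiniteDimensional ℝ E']
  {H' : Type*} [TopologicalSpace H'] {I' : ModelWithCorners ℝ E' H'}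
  {N : Type*} [TopologicalSpace N] [ChartedSpace H' N] [IsManifold I' ∞ N]

/-- A smooth map `f : M → N` is an almost CR map if `df(HM) ⊆ HN` and
`df ∘ J = J^N ∘ df` on `HM`. -/
def IsAlmostCRMap {d d' : ℕ} (S : AlmostCRStructure I M d) (T : AlmostCRStructure I' N d')
    (f : M → N) : Prop :=
  ContMDiff I I' ∞ f ∧
  ∀ (x : M) (v : S.levi x), ∃ h : mfderiv I I' f x (v : TangentSpace I x) ∈ T.levi (f x),
    mfderiv I I' f x (S.J x v : TangentSpace I x) = (T.J (f x) ⟨_, h⟩ : TangentSpace I' (f x))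

end AlmostCRMap

section ComplexBundle

/-- A fibrewise complex linear trivialization is fibrewise real linear. -/
theorem trivialization_isLinear_real {B : Type*} [TopologicalSpace B]
    {F : Type*} [NormedAddCommGroup F] [NormedSpace ℂ F]
    {V : B → Type*} [TopologicalSpace (TotalSpace F V)] [∀ x, AddCommGroup (V x)]
    [∀ x, Module ℂ (V x)] (e : Trivialization F (π F V)) [e.IsLinear ℂ] : e.IsLinear ℝ :=
  ⟨fun b hb ↦
    { map_add := (e.linear ℂ hb).map_add
      map_smul := fun c x ↦ by
        have := (e.linear ℂ hb).map_smul (c : ℂ) x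
        simpa using this }⟩

/-- The real vector bundle underlying a complex vector bundle. -/
instance VectorBundle.complexToReal {B : Type*} [TopologicalSpace B]
    {F : Type*} [NormedAddCommGroup F] [NormedSpace ℂ F]
    {V : B → Type*} [TopologicalSpace (TotalSpace F V)] [∀ x, AddCommGroup (V x)]
    [∀ x, Module ℂ (V x)] [∀ x, TopologicalSpace (V x)] [FiberBundle F V]
    [VectorBundle ℂ F V] : VectorBundle ℝ F V where
  trivialization_linear' e _ := trivialization_isLinear_real e
  continuousOn_coordChange' e e' _ _ := by
    have := trivialization_isLinear_real e
    have := trivialization_isLinear_real e'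
    refine ((ContinuousLinearMap.restrictScalarsL ℂ F F ℝ ℝ).continuous.comp_continuousOn
      (continuousOn_coordChange ℂ e e')).congr fun b hb ↦ ?_
    ext y
    simp [Trivialization.coordChangeL_apply _ _ hb]

variable {E : Type*} [NormedAddCommGroup E] [NormedSpace ℝ E]
  {H : Type*} [TopologicalSpace H] (I : ModelWithCorners ℝ E H)
  {M : Type*} [TopologicalSpace M] [ChartedSpace H M]
  (F : Type*) [NormedAddCommGroup F] [NormedSpace ℂ F]
  {V : M → Type*} [TopologicalSpace (TotalSpace F V)]
  [∀ x, AddCommGroup (V x)] [∀ x, Module ℂ (V x)]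
  [∀ x, TopologicalSpace (V x)] [FiberBundle F V]

/-- The differential `dp` at `v` of the projection `p` of the total space of the bundle. -/
def projDeriv (v : TotalSpace F V) :
    TangentSpace (I.prod 𝓘(ℝ, F)) v →L[ℝ] TangentSpace I v.proj :=
  mfderiv (I.prod 𝓘(ℝ, F)) I (π F V) v

/-- The vertical space at `v`: the kernel of the differential of the projection. -/
def verticalSpace (v : TotalSpace F V) : Submodule ℝ (TangentSpace (I.prod 𝓘(ℝ, F)) v) :=
  LinearMap.ker (projDeriv I F v).toLinearMap

/-- The canonical identification of the fibre through `v` with the vertical space at `v`: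
`u` is sent to the velocity at `t = 0` of the curve `t ↦ v + t u` in the fibre. -/
def verticalLift (v : TotalSpace F V) (u : V v.proj) : TangentSpace (I.prod 𝓘(ℝ, F)) v :=
  mfderiv 𝓘(ℝ, ℝ) (I.prod 𝓘(ℝ, F))
    (fun t : ℝ ↦ (⟨v.proj, v.snd + t • u⟩ : TotalSpace F V)) 0 (1 : ℝ)

/-- The horizontal space at `v` of a linear connection `∇`: the tangent vectors `ds(X)`, for `X`
tangent to the base and `s` a smooth section through `v` with `∇ s = 0` at the base point of `v`.
These vectors form a linear subspace, which is written as a span. -/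
def horizontalSpace [∀ x, IsTopologicalAddGroup (V x)] [∀ x, ContinuousSMul ℝ (V x)]
    (nabla : CovariantDerivative I F V) (v : TotalSpace F V) :
    Submodule ℝ (TangentSpace (I.prod 𝓘(ℝ, F)) v) :=
  Submodule.span ℝ {w | ∃ (s : ∀ x, V x) (X : TangentSpace I v.proj),
    ContMDiff I (I.prod 𝓘(ℝ, F)) ∞ (fun x ↦ (⟨x, s x⟩ : TotalSpace F V)) ∧
    s v.proj = v.snd ∧ nabla s v.proj = 0 ∧
    w = mfderiv I (I.prod 𝓘(ℝ, F)) (fun x ↦ (⟨x, s x⟩ : TotalSpace F V)) v.proj X}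

end ComplexBundle

end

open scoped Topology

noncomputable section

set_option linter.unusedSectionVars false

variable {E : Type*} [NormedAddCommGroup E] [NormedSpace ℝ E]
  {M : Type*} [TopologicalSpace M] [ChartedSpace E M] [IsManifold 𝓘(ℝ, E) ∞ M]
  {F : Type*} [NormedAddCommGroup F] [NormedSpace ℂ F]
  {V : M → Type*} [TopologicalSpace (TotalSpace F V)]
  [∀ x, AddCommGroup (V x)] [∀ x, Module ℂ (V x)] [∀ x, TopologicalSpace (V x)]
  [FiberBundle F V] [VectorBundle ℂ F V] [ContMDiffVectorBundle ∞ F V 𝓘(ℝ, E)]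

/-! ### Coordinates on the tangent bundle of the base, the fibres and the total space -/

/-- The coordinates of a tangent vector at `x` in the chart at `x₀`. -/
def tangentCoord (x₀ x : M) : TangentSpace 𝓘(ℝ, E) x →L[ℝ] E :=
  (trivializationAt E (TangentSpace 𝓘(ℝ, E)) x₀).continuousLinearMapAt ℝ x

variable (F V) in
/-- The coordinates of a vector of the fibre at `x` in the trivialization at `x₀`. -/
def fiberCoord (x₀ x : M) : V x →L[ℝ] F :=
  (trivializationAt F V x₀).continuousLinearMapAt ℝ x

/-- The derivative of the fibre component of the trivialization at `x₀`. -/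
def fiberDeriv (x₀ : M) (v : TotalSpace F V) :
    TangentSpace (𝓘(ℝ, E).prod 𝓘(ℝ, F)) v →L[ℝ] F :=
  mfderiv (𝓘(ℝ, E).prod 𝓘(ℝ, F)) 𝓘(ℝ, F) (fun v ↦ (trivializationAt F V x₀ v).2) v

variable (E F V) in
/-- The set over which both the chart and the trivialization at `x₀` are defined. -/
def coordDomain (x₀ : M) : Set M := (trivializationAt F V x₀).baseSet ∩ (chartAt E x₀).source

theorem isOpen_coordDomain (x₀ : M) : IsOpen (coordDomain E F V x₀) :=
  (trivializationAt F V x₀).open_baseSet.inter (chartAt E x₀).open_source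

theorem mem_coordDomain_self (x₀ : M) : x₀ ∈ coordDomain E F V x₀ :=
  ⟨mem_baseSet_trivializationAt F V x₀, mem_chart_source E x₀⟩

theorem tangentCoord_apply {x₀ x : M} (hx : x ∈ (chartAt E x₀).source)
    (X : TangentSpace 𝓘(ℝ, E) x) :
    tangentCoord x₀ x X = (trivializationAt E (TangentSpace 𝓘(ℝ, E)) x₀ ⟨x, X⟩).2 := by
  rw [tangentCoord, Trivialization.continuousLinearMapAt_apply,
    Trivialization.coe_linearMapAt_of_mem]
  simpa using hx

theorem tangentCoord_bijective {x₀ x : M} (hx : x ∈ (chartAt E x₀).source) :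
    Function.Bijective (tangentCoord x₀ x : TangentSpace 𝓘(ℝ, E) x →L[ℝ] E) := by
  have hx' : x ∈ (trivializationAt E (TangentSpace 𝓘(ℝ, E)) x₀).baseSet := by simpa using hx
  rw [tangentCoord, ← Trivialization.coe_continuousLinearEquivAt_eq _ hx']
  exact ContinuousLinearEquiv.bijective _

theorem fiberCoord_apply {x₀ x : M} (hx : x ∈ (trivializationAt F V x₀).baseSet) (u : V x) :
    fiberCoord F V x₀ x u = (trivializationAt F V x₀ ⟨x, u⟩).2 := by
  rw [fiberCoord, Trivialization.continuousLinearMapAt_apply,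
    Trivialization.coe_linearMapAt_of_mem _ hx]

theorem fiberCoord_bijective {x₀ x : M} (hx : x ∈ (trivializationAt F V x₀).baseSet) :
    Function.Bijective (fiberCoord F V x₀ x) := by
  rw [fiberCoord, ← Trivialization.coe_continuousLinearEquivAt_eq _ hx]
  exact ContinuousLinearEquiv.bijective _

theorem fiberCoord_smul {x₀ x : M} (hx : x ∈ (trivializationAt F V x₀).baseSet) (c : ℂ)
    (u : V x) : fiberCoord F V x₀ x (c • u) = c • fiberCoord F V x₀ x u := by
  rw [fiberCoord_apply hx, fiberCoord_apply hx]
  exact ((trivializationAt F V x₀).linear ℂ hx).map_smul c u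

theorem contMDiffAt_fiberComponent (x₀ : M) {v : TotalSpace F V}
    (hv : v.proj ∈ (trivializationAt F V x₀).baseSet) :
    ContMDiffAt (𝓘(ℝ, E).prod 𝓘(ℝ, F)) 𝓘(ℝ, F) ∞
      (fun v : TotalSpace F V ↦ (trivializationAt F V x₀ v).2) v :=
  (((trivializationAt F V x₀).contMDiffAt_iff
    ((trivializationAt F V x₀).mem_source.2 hv)).1 contMDiffAt_id).2

variable [FiniteDimensional ℝ E]

/-- In the chart of the total space at `v₀`, a tangent vector is the pair of the coordinates of its
projection and of its fibre component. -/
theorem continuousLinearMapAt_totalSpace {v₀ v : TotalSpace F V}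
    (hv : v.proj ∈ coordDomain E F V v₀.proj) (w : TangentSpace (𝓘(ℝ, E).prod 𝓘(ℝ, F)) v) :
    (trivializationAt (E × F) (TangentSpace (𝓘(ℝ, E).prod 𝓘(ℝ, F))) v₀).continuousLinearMapAt ℝ v w
      = (tangentCoord v₀.proj v.proj (projDeriv 𝓘(ℝ, E) F v w), fiberDeriv v₀.proj v w) := by
  have hsrc : v ∈ (chartAt (ModelProd E F) v₀).source := by
    rw [FiberBundle.chartedSpace_chartAt]
    simp [hv.1, hv.2, Trivialization.mem_source]
  rw [TangentBundle.continuousLinearMapAt_trivializationAt hsrc]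
  have hext : MDifferentiableAt 𝓘(ℝ, E) 𝓘(ℝ, E) (extChartAt 𝓘(ℝ, E) v₀.proj) v.proj :=
    mdifferentiableAt_extChartAt hv.2
  have hpr : MDifferentiableAt (𝓘(ℝ, E).prod 𝓘(ℝ, F)) 𝓘(ℝ, E) (π F V) v :=
    mdifferentiableAt_proj V
  have key : (extChartAt (𝓘(ℝ, E).prod 𝓘(ℝ, F)) v₀ : TotalSpace F V → E × F) =ᶠ[𝓝 v]
      fun v ↦ ((extChartAt 𝓘(ℝ, E) v₀.proj ∘ π F V) v, (trivializationAt F V v₀.proj v).2) := by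
    have : (π F V) ⁻¹' (trivializationAt F V v₀.proj).baseSet ∈ 𝓝 v :=
      ((trivializationAt F V v₀.proj).open_baseSet.preimage
        (FiberBundle.continuous_proj F V)).mem_nhds hv.1
    filter_upwards [this] with y hy
    rw [FiberBundle.extChartAt]
    simp [Trivialization.coe_fst' _ hy]
  have h₁ := hext.hasMFDerivAt.comp v hpr.hasMFDerivAt
  have h₂ := ((contMDiffAt_fiberComponent (E := E) v₀.proj hv.1).mdifferentiableAt
    (by simp)).hasMFDerivAt
  have hd : HasMFDerivAt (𝓘(ℝ, E).prod 𝓘(ℝ, F)) 𝓘(ℝ, E × F)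
      (fun v ↦ ((extChartAt 𝓘(ℝ, E) v₀.proj ∘ π F V) v, (trivializationAt F V v₀.proj v).2)) v
      (ContinuousLinearMap.prod _ _) := ⟨h₁.1.prodMk h₂.1, h₁.2.prodMk h₂.2⟩
  rw [(hd.congr_of_eventuallyEq key).mfderiv, tangentCoord,
    TangentBundle.continuousLinearMapAt_trivializationAt hv.2]
  rfl

theorem mem_baseSet_of_mem_coordDomain {x₀ : M} {v : TotalSpace F V}
    (hv : v.proj ∈ coordDomain E F V x₀) :
    v ∈ (trivializationAt (E × F) (TangentSpace (𝓘(ℝ, E).prod 𝓘(ℝ, F)))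
      (⟨x₀, 0⟩ : TotalSpace F V)).baseSet := by
  rw [TangentBundle.trivializationAt_baseSet, FiberBundle.chartedSpace_chartAt]
  simp [hv.1, hv.2, Trivialization.mem_source]

theorem coord_bijective {x₀ : M} {v : TotalSpace F V} (hv : v.proj ∈ coordDomain E F V x₀) :
    Function.Bijective fun w : TangentSpace (𝓘(ℝ, E).prod 𝓘(ℝ, F)) v ↦
      ((tangentCoord x₀ v.proj (projDeriv 𝓘(ℝ, E) F v w), fiberDeriv x₀ v w) : E × F) := by
  have hb := mem_baseSet_of_mem_coordDomain hv
  have := (Trivialization.continuousLinearEquivAt ℝ (trivializationAt (E × F)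
    (TangentSpace (𝓘(ℝ, E).prod 𝓘(ℝ, F))) (⟨x₀, 0⟩ : TotalSpace F V)) v hb).bijective
  rw [Trivialization.coe_continuousLinearEquivAt_eq] at this
  convert this using 1
  ext1 w
  exact (continuousLinearMapAt_totalSpace (v₀ := ⟨x₀, 0⟩) hv w).symm

theorem coord_injective {x₀ : M} {v : TotalSpace F V} (hv : v.proj ∈ coordDomain E F V x₀)
    {w w' : TangentSpace (𝓘(ℝ, E).prod 𝓘(ℝ, F)) v}
    (h₁ : projDeriv 𝓘(ℝ, E) F v w = projDeriv 𝓘(ℝ, E) F v w')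
    (h₂ : fiberDeriv x₀ v w = fiberDeriv x₀ v w') : w = w' :=
  (coord_bijective hv).1 (by simp only [h₁, h₂])

theorem coord_surjective {x₀ : M} {v : TotalSpace F V} (hv : v.proj ∈ coordDomain E F V x₀)
    (X : TangentSpace 𝓘(ℝ, E) v.proj) (f : F) :
    ∃ w : TangentSpace (𝓘(ℝ, E).prod 𝓘(ℝ, F)) v,
      projDeriv 𝓘(ℝ, E) F v w = X ∧ fiberDeriv x₀ v w = f := by
  obtain ⟨w, hw⟩ := (coord_bijective hv).2 (tangentCoord x₀ v.proj X, f)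
  exact ⟨w, (tangentCoord_bijective hv.2).1 (Prod.ext_iff.1 hw).1, (Prod.ext_iff.1 hw).2⟩

theorem contMDiffAt_vectorField_base_iff {x₀ x₁ : M} (hx : x₁ ∈ (chartAt E x₀).source)
    {X : ∀ x : M, TangentSpace 𝓘(ℝ, E) x} :
    ContMDiffAt 𝓘(ℝ, E) 𝓘(ℝ, E).tangent ∞ (fun x ↦ (⟨x, X x⟩ : TangentBundle 𝓘(ℝ, E) M)) x₁ ↔
      ContMDiffAt 𝓘(ℝ, E) 𝓘(ℝ, E) ∞ (fun x ↦ tangentCoord x₀ x (X x)) x₁ := by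
  refine ((trivializationAt E (TangentSpace 𝓘(ℝ, E)) x₀).contMDiffAt_section_iff
    (by simpa using hx)).trans (Filter.EventuallyEq.contMDiffAt_iff ?_)
  filter_upwards [(chartAt E x₀).open_source.mem_nhds hx] with y hy
  rw [tangentCoord_apply hy]

/-- A vector field on the total space is smooth at `v₁` if and only if its coordinates are. -/
theorem contMDiffAt_vectorField_iff {x₀ : M} {v₁ : TotalSpace F V}
    (hv₁ : v₁.proj ∈ coordDomain E F V x₀)
    {W : ∀ v : TotalSpace F V, TangentSpace (𝓘(ℝ, E).prod 𝓘(ℝ, F)) v} :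
    ContMDiffAt (𝓘(ℝ, E).prod 𝓘(ℝ, F)) (𝓘(ℝ, E).prod 𝓘(ℝ, F)).tangent ∞
      (fun v ↦ (⟨v, W v⟩ : TangentBundle (𝓘(ℝ, E).prod 𝓘(ℝ, F)) (TotalSpace F V))) v₁ ↔
    ContMDiffAt (𝓘(ℝ, E).prod 𝓘(ℝ, F)) 𝓘(ℝ, E) ∞
      (fun v ↦ tangentCoord x₀ v.proj (projDeriv 𝓘(ℝ, E) F v (W v))) v₁ ∧
    ContMDiffAt (𝓘(ℝ, E).prod 𝓘(ℝ, F)) 𝓘(ℝ, F) ∞ (fun v ↦ fiberDeriv x₀ v (W v)) v₁ := by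
  have hb := mem_baseSet_of_mem_coordDomain hv₁
  have h := (trivializationAt (E × F) (TangentSpace (𝓘(ℝ, E).prod 𝓘(ℝ, F)))
    (⟨x₀, 0⟩ : TotalSpace F V)).contMDiffAt_section_iff (IB := 𝓘(ℝ, E).prod 𝓘(ℝ, F)) (n := ∞)
      (s := W) hb
  refine h.trans ?_
  have key : (fun v ↦ (trivializationAt (E × F) (TangentSpace (𝓘(ℝ, E).prod 𝓘(ℝ, F)))
      (⟨x₀, 0⟩ : TotalSpace F V) ⟨v, W v⟩).2) =ᶠ[𝓝 v₁] fun v ↦ ((tangentCoord x₀ v.proj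
        (projDeriv 𝓘(ℝ, E) F v (W v)), fiberDeriv x₀ v (W v)) : E × F) := by
    filter_upwards [(FiberBundle.continuous_proj F V).continuousAt.preimage_mem_nhds
      ((isOpen_coordDomain (E := E) x₀).mem_nhds hv₁)] with v hv
    refine Eq.trans ?_ (continuousLinearMapAt_totalSpace (v₀ := ⟨x₀, 0⟩) hv (W v))
    rw [Trivialization.continuousLinearMapAt_apply,
      Trivialization.coe_linearMapAt_of_mem _ (mem_baseSet_of_mem_coordDomain hv)]
  rw [key.contMDiffAt_iff]
  exact contMDiffAt_prod_module_iff _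

/-! ### The connection form in a local trivialization -/

theorem contMDiffAt_section_iff_fiberCoord {x₀ x : M} (hx : x ∈ (trivializationAt F V x₀).baseSet)
    (n : WithTop ℕ∞) [ContMDiffVectorBundle n F V 𝓘(ℝ, E)] {s : ∀ x, V x} :
    ContMDiffAt 𝓘(ℝ, E) (𝓘(ℝ, E).prod 𝓘(ℝ, F)) n (fun x ↦ (⟨x, s x⟩ : TotalSpace F V)) x ↔
      ContMDiffAt 𝓘(ℝ, E) 𝓘(ℝ, F) n (fun y ↦ fiberCoord F V x₀ y (s y)) x := by
  refine ((trivializationAt F V x₀).contMDiffAt_section_iff hx).trans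
    (Filter.EventuallyEq.contMDiffAt_iff ?_)
  filter_upwards [(trivializationAt F V x₀).open_baseSet.mem_nhds hx] with y hy
  rw [fiberCoord_apply hy]

/-- Every smooth local section agrees near a given point with a smooth global section. -/
theorem exists_contMDiff_section [T2Space M] {x₀ x₁ : M} (hx₁ : x₁ ∈ coordDomain E F V x₀)
    {g : M → F} (hg : ContMDiffOn 𝓘(ℝ, E) 𝓘(ℝ, F) ∞ g (coordDomain E F V x₀)) :
    ∃ s : ∀ x, V x,
      ContMDiff 𝓘(ℝ, E) (𝓘(ℝ, E).prod 𝓘(ℝ, F)) ∞ (fun x ↦ (⟨x, s x⟩ : TotalSpace F V)) ∧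
      ∀ᶠ y in 𝓝 x₁, fiberCoord F V x₀ y (s y) = g y := by
  have ho := isOpen_coordDomain (E := E) (F := F) (V := V) x₀
  obtain ⟨χ, -, hχ⟩ := ((SmoothBumpFunction.nhds_basis_tsupport (I := 𝓘(ℝ, E)) x₁).mem_iff).1
    (ho.mem_nhds hx₁)
  have hcoord : ∀ y ∈ coordDomain E F V x₀,
      fiberCoord F V x₀ y ((trivializationAt F V x₀).symmL ℝ y (g y)) = g y := fun y hy ↦
    (trivializationAt F V x₀).continuousLinearMapAt_symmL hy.1 (g y)
  refine ⟨(χ : M → ℝ) • fun y ↦ (trivializationAt F V x₀).symmL ℝ y (g y),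
    ContMDiffOn.smul_section_of_tsupport χ.contMDiff.contMDiffOn ho hχ ?_, ?_⟩
  · intro y hy
    refine ((contMDiffAt_section_iff_fiberCoord hy.1 ∞).2 ?_).contMDiffWithinAt
    refine (hg.contMDiffAt (ho.mem_nhds hy)).congr_of_eventuallyEq ?_
    filter_upwards [ho.mem_nhds hy] with z hz using hcoord z hz
  · filter_upwards [χ.eventuallyEq_one, ho.mem_nhds hx₁] with y hy hy'
    simp [hy, hcoord y hy']

variable [∀ x, IsTopologicalAddGroup (V x)] [∀ x, ContinuousSMul ℝ (V x)]

theorem CovariantDerivative.map_sum_smul (nabla : CovariantDerivative 𝓘(ℝ, E) F V)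
    {ι : Type*} (t : Finset ι) {g : ι → M → ℝ} {σ : ι → ∀ x, V x} {x : M}
    (hg : ∀ i, MDifferentiableAt 𝓘(ℝ, E) 𝓘(ℝ, ℝ) (g i) x)
    (hσ : ∀ i, MDifferentiableAt 𝓘(ℝ, E) (𝓘(ℝ, E).prod 𝓘(ℝ, F))
      (fun x ↦ (⟨x, σ i x⟩ : TotalSpace F V)) x) (X : TangentSpace 𝓘(ℝ, E) x) :
    nabla (fun y ↦ ∑ i ∈ t, g i y • σ i y) x X =
      ∑ i ∈ t, (g i x • nabla (σ i) x X + mvfderiv 𝓘(ℝ, E) (g i) x X • σ i x) := by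
  classical
  induction t using Finset.induction_on with
  | empty =>
    simp only [Finset.sum_empty]
    exact congrArg (· X) (congrFun nabla.zero x)
  | insert a t ha ih =>
    simp only [Finset.sum_insert ha, ← ih]
    have h₁ : MDifferentiableAt 𝓘(ℝ, E) (𝓘(ℝ, E).prod 𝓘(ℝ, F))
        (fun x ↦ (⟨x, (g a • σ a) x⟩ : TotalSpace F V)) x := (hg a).smul_section (hσ a)
    have h₂ : MDifferentiableAt 𝓘(ℝ, E) (𝓘(ℝ, E).prod 𝓘(ℝ, F))
        (fun x ↦ (⟨x, ∑ i ∈ t, g i x • σ i x⟩ : TotalSpace F V)) x :=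
      MDifferentiableAt.sum_section fun i _ ↦ (hg i).smul_section (hσ i)
    have h₃ := nabla.isCovariantDerivativeOnUniv.add h₁ h₂
    have h₄ := nabla.isCovariantDerivativeOnUniv.leibniz (hσ a) (hg a)
    have h₅ := congrArg (· X) h₃
    rw [h₄] at h₅
    exact h₅

/-- `G` is the connection form of `∇` over `U` in the trivialization and the chart at `x₀`. -/
structure IsConnectionForm (nabla : CovariantDerivative 𝓘(ℝ, E) F V) (x₀ : M) (U : Set M)
    (G : M → E →L[ℝ] F →L[ℝ] F) : Prop where
  isOpen : IsOpen U
  mem : x₀ ∈ U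
  subset : U ⊆ coordDomain E F V x₀
  contMDiffAt : ContMDiffAt 𝓘(ℝ, E) 𝓘(ℝ, E →L[ℝ] F →L[ℝ] F) ∞ G x₀
  fiberCoord_nabla : ∀ x ∈ U, ∀ s : ∀ x, V x,
    MDifferentiableAt 𝓘(ℝ, E) (𝓘(ℝ, E).prod 𝓘(ℝ, F)) (fun x ↦ (⟨x, s x⟩ : TotalSpace F V)) x →
    ∀ X : TangentSpace 𝓘(ℝ, E) x, fiberCoord F V x₀ x (nabla s x X) =
      mvfderiv 𝓘(ℝ, E) (fun y ↦ fiberCoord F V x₀ y (s y)) x X +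
        G x (tangentCoord x₀ x X) (fiberCoord F V x₀ x (s x))

theorem exists_isConnectionForm [T2Space M] [FiniteDimensional ℂ F]
    (nabla : CovariantDerivative 𝓘(ℝ, E) F V) [nabla.ContMDiffCovariantDerivative ∞] (x₀ : M) :
    ∃ U G, IsConnectionForm nabla x₀ U G := by
  let b := Module.finBasis ℝ F
  choose σ hσ hσb using fun i ↦ exists_contMDiff_section (E := E) (V := V) (x₀ := x₀)
    (mem_coordDomain_self x₀) (g := fun _ ↦ b i) contMDiffOn_const
  obtain ⟨U, hU, hUo, hxU⟩ := eventually_nhds_iff.1 (Filter.eventually_all.2 hσb)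
  let c : Fin (finrank ℝ F) → F →L[ℝ] ℝ := fun i ↦ LinearMap.toContinuousLinearMap (b.coord i)
  let N : Fin (finrank ℝ F) → M → E →L[ℝ] F := fun i x ↦
    ContinuousLinearMap.inCoordinates E (TangentSpace 𝓘(ℝ, E)) F V x₀ x x₀ x (nabla (σ i) x)
  refine ⟨U ∩ coordDomain E F V x₀, fun x ↦ ∑ i,
    (ContinuousLinearMap.smulRightL ℝ F F (c i)).comp (N i x),
    hUo.inter (isOpen_coordDomain x₀), ⟨hxU, mem_coordDomain_self x₀⟩, Set.inter_subset_right,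
    ?_, ?_⟩
  · have hNs : ∀ i, ContMDiffAt 𝓘(ℝ, E) 𝓘(ℝ, E →L[ℝ] F) ∞ (N i) x₀ := fun i ↦
      ((contMDiffAt_hom_bundle _).1 ((CovariantDerivative.ContMDiffCovariantDerivative.contMDiff
        (cov := nabla) (k := ∞)).contMDiff ((hσ i).contMDiffOn (s := Set.univ))
          |>.contMDiffAt Filter.univ_mem)).2
    exact contMDiffAt_finsetSum fun i _ ↦ contMDiffAt_const.clm_comp (hNs i)
  rintro x ⟨hx, hxd⟩ s hs X
  have hN : ∀ i, N i x (tangentCoord x₀ x X) = fiberCoord F V x₀ x (nabla (σ i) x X) := by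
    intro i
    have hx' : x ∈ (trivializationAt E (TangentSpace 𝓘(ℝ, E)) x₀).baseSet := by
      simpa using hxd.2
    change fiberCoord F V x₀ x (nabla (σ i) x ((trivializationAt E (TangentSpace 𝓘(ℝ, E))
      x₀).symmL ℝ x (tangentCoord x₀ x X))) = _
    rw [tangentCoord, Trivialization.symmL_continuousLinearMapAt _ hx']
  let g : Fin (finrank ℝ F) → M → ℝ := fun i y ↦ c i (fiberCoord F V x₀ y (s y))
  have hφ : MDifferentiableAt 𝓘(ℝ, E) 𝓘(ℝ, F) (fun y ↦ fiberCoord F V x₀ y (s y)) x := by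
    refine (((trivializationAt F V x₀).mdifferentiableAt_section_iff 𝓘(ℝ, E) s hxd.1).1
      hs).congr_of_eventuallyEq ?_
    filter_upwards [(isOpen_coordDomain x₀).mem_nhds hxd] with y hy
    rw [fiberCoord_apply hy.1]
  have hg : ∀ i, HasMFDerivAt 𝓘(ℝ, E) 𝓘(ℝ, ℝ) (g i) x
      ((c i).comp (mvfderiv 𝓘(ℝ, E) (fun y ↦ fiberCoord F V x₀ y (s y)) x)) := fun i ↦
    (c i).hasMFDerivAt.comp x hφ.hasMFDerivAt
  have hsum : ∀ᶠ y in 𝓝 x, s y = ∑ i, g i y • σ i y := by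
    filter_upwards [hUo.mem_nhds hx, (isOpen_coordDomain x₀).mem_nhds hxd] with y hy hyd
    apply (fiberCoord_bijective hyd.1).1
    rw [map_sum]
    simp only [map_smul, hU y hy]
    exact (b.sum_repr _).symm
  have hσx : ∀ i, MDifferentiableAt 𝓘(ℝ, E) (𝓘(ℝ, E).prod 𝓘(ℝ, F))
      (fun x ↦ (⟨x, σ i x⟩ : TotalSpace F V)) x := fun i ↦ (hσ i x).mdifferentiableAt (by simp)
  have hgσ : MDifferentiableAt 𝓘(ℝ, E) (𝓘(ℝ, E).prod 𝓘(ℝ, F))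
      (fun x ↦ (⟨x, ∑ i, g i x • σ i x⟩ : TotalSpace F V)) x :=
    MDifferentiableAt.sum_section fun i _ ↦ (hg i).mdifferentiableAt.smul_section (hσx i)
  rw [nabla.isCovariantDerivativeOnUniv.congr_of_eventuallyEq hs hgσ Filter.univ_mem hsum,
    nabla.map_sum_smul Finset.univ (fun i ↦ (hg i).mdifferentiableAt) hσx, map_sum]
  simp only [map_add, map_smul, hU x hx, Finset.sum_add_distrib]
  rw [add_comm]
  congr 1
  · have : ∀ i, mvfderiv 𝓘(ℝ, E) (g i) x X =
        c i (mvfderiv 𝓘(ℝ, E) (fun y ↦ fiberCoord F V x₀ y (s y)) x X) := fun i ↦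
      congrArg (· X) (hg i).mfderiv
    simp only [this]
    exact b.sum_repr _
  · simp only [sum_apply, ContinuousLinearMap.comp_apply, hN]
    rfl

/-! ### Horizontal and vertical vectors -/

theorem mdifferentiableAt_fiberComponent {x₀ : M} {v : TotalSpace F V}
    (hv : v.proj ∈ (trivializationAt F V x₀).baseSet) :
    MDifferentiableAt (𝓘(ℝ, E).prod 𝓘(ℝ, F)) 𝓘(ℝ, F)
      (fun v : TotalSpace F V ↦ (trivializationAt F V x₀ v).2) v :=
  (contMDiffAt_fiberComponent x₀ hv).mdifferentiableAt (by simp)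

section SectionDerivative

variable {s : ∀ x, V x} {x : M} (hs : MDifferentiableAt 𝓘(ℝ, E) (𝓘(ℝ, E).prod 𝓘(ℝ, F))
  (fun x ↦ (⟨x, s x⟩ : TotalSpace F V)) x) (X : TangentSpace 𝓘(ℝ, E) x)

include hs in
theorem projDeriv_mfderiv_section :
    projDeriv 𝓘(ℝ, E) F (⟨x, s x⟩ : TotalSpace F V)
      (mfderiv 𝓘(ℝ, E) (𝓘(ℝ, E).prod 𝓘(ℝ, F)) (fun x ↦ (⟨x, s x⟩ : TotalSpace F V)) x X) = X := by
  have h := mfderiv_comp_apply x (g := π F V) (I' := 𝓘(ℝ, E).prod 𝓘(ℝ, F)) (I'' := 𝓘(ℝ, E))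
    (mdifferentiableAt_proj V) hs X
  have h' : (π F V ∘ fun x ↦ (⟨x, s x⟩ : TotalSpace F V)) = id := rfl
  rw [h', mfderiv_id] at h
  exact h.symm

include hs in
theorem fiberDeriv_mfderiv_section {x₀ : M} (hx : x ∈ (trivializationAt F V x₀).baseSet) :
    fiberDeriv x₀ (⟨x, s x⟩ : TotalSpace F V)
      (mfderiv 𝓘(ℝ, E) (𝓘(ℝ, E).prod 𝓘(ℝ, F)) (fun x ↦ (⟨x, s x⟩ : TotalSpace F V)) x X) =
      mvfderiv 𝓘(ℝ, E) (fun y ↦ fiberCoord F V x₀ y (s y)) x X := by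
  have h := mfderiv_comp_apply x (g := fun v : TotalSpace F V ↦ (trivializationAt F V x₀ v).2)
    (mdifferentiableAt_fiberComponent (E := E) hx) hs X
  have h' : (fun y ↦ fiberCoord F V x₀ y (s y)) =ᶠ[𝓝 x]
      ((fun v : TotalSpace F V ↦ (trivializationAt F V x₀ v).2) ∘
        fun x ↦ (⟨x, s x⟩ : TotalSpace F V)) := by
    filter_upwards [(trivializationAt F V x₀).open_baseSet.mem_nhds hx] with y hy
    exact fiberCoord_apply hy (s y)
  refine h.symm.trans ?_
  exact (congrArg (· X) (h'.mfderiv_eq (I := 𝓘(ℝ, E)) (I' := 𝓘(ℝ, F)))).symm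

end SectionDerivative

theorem mdifferentiableAt_fiberLine (v : TotalSpace F V) (u : V v.proj) (t : ℝ) :
    MDifferentiableAt 𝓘(ℝ, ℝ) (𝓘(ℝ, E).prod 𝓘(ℝ, F))
      (fun t : ℝ ↦ (⟨v.proj, v.snd + t • u⟩ : TotalSpace F V)) t := by
  refine (mdifferentiableAt_totalSpace 𝓘(ℝ, E) _).2 ⟨mdifferentiableAt_const, ?_⟩
  have : (fun t : ℝ ↦ (trivializationAt F V v.proj ⟨v.proj, v.snd + t • u⟩).2) =
      fun t ↦ fiberCoord F V v.proj v.proj v.snd + t • fiberCoord F V v.proj v.proj u := by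
    ext t
    rw [← fiberCoord_apply (mem_baseSet_trivializationAt F V v.proj), map_add, map_smul]
  change MDifferentiableAt 𝓘(ℝ, ℝ) 𝓘(ℝ, F)
    (fun t : ℝ ↦ (trivializationAt F V v.proj ⟨v.proj, v.snd + t • u⟩).2) t
  rw [this, mdifferentiableAt_iff_differentiableAt]
  fun_prop

theorem projDeriv_verticalLift (v : TotalSpace F V) (u : V v.proj) :
    projDeriv 𝓘(ℝ, E) F v (verticalLift 𝓘(ℝ, E) F v u) = 0 := by
  have hv : (⟨v.proj, v.snd + (0 : ℝ) • u⟩ : TotalSpace F V) = v := by simp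
  have h := mfderiv_comp_apply_of_eq (0 : ℝ) (g := π F V)
    (f := fun t : ℝ ↦ (⟨v.proj, v.snd + t • u⟩ : TotalSpace F V))
    (I' := 𝓘(ℝ, E).prod 𝓘(ℝ, F)) (I'' := 𝓘(ℝ, E)) (mdifferentiableAt_proj V)
    (mdifferentiableAt_fiberLine v u 0) hv (1 : ℝ)
  have h' : (π F V ∘ fun t : ℝ ↦ (⟨v.proj, v.snd + t • u⟩ : TotalSpace F V)) =
    fun _ ↦ v.proj := rfl
  rw [h', mfderiv_const] at h
  exact h.symm

theorem fiberDeriv_verticalLift {x₀ : M} {v : TotalSpace F V}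
    (hv : v.proj ∈ (trivializationAt F V x₀).baseSet) (u : V v.proj) :
    fiberDeriv x₀ v (verticalLift 𝓘(ℝ, E) F v u) = fiberCoord F V x₀ v.proj u := by
  have hv0 : (⟨v.proj, v.snd + (0 : ℝ) • u⟩ : TotalSpace F V) = v := by simp
  have h := mfderiv_comp_apply_of_eq (0 : ℝ)
    (g := fun v : TotalSpace F V ↦ (trivializationAt F V x₀ v).2)
    (f := fun t : ℝ ↦ (⟨v.proj, v.snd + t • u⟩ : TotalSpace F V))
    (I' := 𝓘(ℝ, E).prod 𝓘(ℝ, F)) (I'' := 𝓘(ℝ, F)) (mdifferentiableAt_fiberComponent hv)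
    (mdifferentiableAt_fiberLine v u 0) hv0 (1 : ℝ)
  have h' : ((fun v : TotalSpace F V ↦ (trivializationAt F V x₀ v).2) ∘
      fun t : ℝ ↦ (⟨v.proj, v.snd + t • u⟩ : TotalSpace F V)) =
      fun t ↦ fiberCoord F V x₀ v.proj v.snd + t • fiberCoord F V x₀ v.proj u := by
    ext t
    change (trivializationAt F V x₀ ⟨v.proj, v.snd + t • u⟩).2 = _
    rw [← fiberCoord_apply hv, map_add, map_smul]
  refine h.symm.trans ?_
  rw [h', mfderiv_eq_fderiv]
  have hd : HasDerivAt (fun t : ℝ ↦ fiberCoord F V x₀ v.proj v.snd + t • fiberCoord F V x₀ v.proj u)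
      (fiberCoord F V x₀ v.proj u) 0 := by
    simpa using ((hasDerivAt_id (0 : ℝ)).smul_const (fiberCoord F V x₀ v.proj u)).const_add
      (fiberCoord F V x₀ v.proj v.snd)
  exact hd.deriv

/-- The vertical component of a tangent vector with respect to the connection form `G`, in the
trivialization at `x₀`. -/
def localConnector (x₀ : M) (G : M → E →L[ℝ] F →L[ℝ] F) (v : TotalSpace F V) :
    TangentSpace (𝓘(ℝ, E).prod 𝓘(ℝ, F)) v →L[ℝ] F :=
  fiberDeriv x₀ v + (((G v.proj).flip (fiberCoord F V x₀ v.proj v.snd)).comp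
    (tangentCoord x₀ v.proj)).comp (projDeriv 𝓘(ℝ, E) F v)

theorem localConnector_apply (x₀ : M) (G : M → E →L[ℝ] F →L[ℝ] F) (v : TotalSpace F V)
    (w : TangentSpace (𝓘(ℝ, E).prod 𝓘(ℝ, F)) v) :
    localConnector x₀ G v w = fiberDeriv x₀ v w +
      G v.proj (tangentCoord x₀ v.proj (projDeriv 𝓘(ℝ, E) F v w))
        (fiberCoord F V x₀ v.proj v.snd) := rfl

theorem localConnector_verticalLift {x₀ : M} (G : M → E →L[ℝ] F →L[ℝ] F) {v : TotalSpace F V}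
    (hv : v.proj ∈ (trivializationAt F V x₀).baseSet) (u : V v.proj) :
    localConnector x₀ G v (verticalLift 𝓘(ℝ, E) F v u) = fiberCoord F V x₀ v.proj u := by
  rw [localConnector_apply, projDeriv_verticalLift, fiberDeriv_verticalLift hv]
  simp

theorem IsConnectionForm.horizontalSpace_eq [T2Space M]
    {nabla : CovariantDerivative 𝓘(ℝ, E) F V} {x₀ : M} {U : Set M} {G : M → E →L[ℝ] F →L[ℝ] F}
    (h : IsConnectionForm nabla x₀ U G) {v : TotalSpace F V} (hv : v.proj ∈ U) :
    horizontalSpace 𝓘(ℝ, E) F nabla v = LinearMap.ker (localConnector x₀ G v).toLinearMap := by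
  obtain ⟨x, u⟩ := v
  have hxd : x ∈ coordDomain E F V x₀ := h.subset hv
  apply le_antisymm
  · refine Submodule.span_le.2 ?_
    rintro w ⟨s, X, hs, hsv, hns, rfl⟩
    obtain rfl : s x = u := hsv
    have hsx : MDifferentiableAt 𝓘(ℝ, E) (𝓘(ℝ, E).prod 𝓘(ℝ, F))
      (fun x ↦ (⟨x, s x⟩ : TotalSpace F V)) x := (hs x).mdifferentiableAt (by simp)
    change localConnector x₀ G (⟨x, s x⟩ : TotalSpace F V) _ = 0
    rw [localConnector_apply, fiberDeriv_mfderiv_section hsx X hxd.1,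
      projDeriv_mfderiv_section hsx X]
    refine (h.fiberCoord_nabla x hv s hsx X).symm.trans ?_
    have : nabla s x = 0 := hns
    simp [this]
  · intro w hw
    set f := fiberCoord F V x₀ x u with hf
    let L : E →L[ℝ] F := (G x).flip f
    let g : M → F := fun y ↦ f - L (extChartAt 𝓘(ℝ, E) x₀ y - extChartAt 𝓘(ℝ, E) x₀ x)
    have hg : ContMDiffOn 𝓘(ℝ, E) 𝓘(ℝ, F) ∞ g (coordDomain E F V x₀) :=
      contMDiffOn_const.sub (L.contMDiff.comp_contMDiffOn
        ((contMDiffOn_extChartAt.mono fun y hy ↦ hy.2).sub contMDiffOn_const))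
    obtain ⟨s, hs, hsg⟩ := exists_contMDiff_section hxd hg
    have hsu : s x = u := (fiberCoord_bijective hxd.1).1 (by rw [hsg.self_of_nhds, ← hf]; simp [g])
    subst hsu
    have hsx : MDifferentiableAt 𝓘(ℝ, E) (𝓘(ℝ, E).prod 𝓘(ℝ, F))
      (fun x ↦ (⟨x, s x⟩ : TotalSpace F V)) x := (hs x).mdifferentiableAt (by simp)
    have hder : ∀ X : TangentSpace 𝓘(ℝ, E) x,
        mvfderiv 𝓘(ℝ, E) (fun y ↦ fiberCoord F V x₀ y (s y)) x X =
          - G x (tangentCoord x₀ x X) f := by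
      intro X
      have hext : HasMFDerivAt 𝓘(ℝ, E) 𝓘(ℝ, E) (extChartAt 𝓘(ℝ, E) x₀) x (tangentCoord x₀ x) := by
        rw [tangentCoord, TangentBundle.continuousLinearMapAt_trivializationAt hxd.2]
        exact (mdifferentiableAt_extChartAt hxd.2).hasMFDerivAt
      have hA : HasFDerivAt (fun e : E ↦ f - L (e - extChartAt 𝓘(ℝ, E) x₀ x)) (-L)
          (extChartAt 𝓘(ℝ, E) x₀ x) := by
        simp only [map_sub]
        exact (L.hasFDerivAt.sub_const _).const_sub f
      have hgd := (hA.hasMFDerivAt.comp x hext).mfderiv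
      have hsg' : (fun y ↦ fiberCoord F V x₀ y (s y)) =ᶠ[𝓝 x] g := hsg
      refine (congrArg (· X) (hsg'.mfderiv_eq (I := 𝓘(ℝ, E)) (I' := 𝓘(ℝ, F)))).trans ?_
      exact congrArg (· X) hgd
    refine Submodule.subset_span ⟨s, projDeriv 𝓘(ℝ, E) F _ w, hs, rfl, ?_, ?_⟩
    · ext X
      refine (fiberCoord_bijective hxd.1).1 ?_
      rw [h.fiberCoord_nabla x hv s hsx X, hder]
      simp [hf]
    · refine coord_injective (x₀ := x₀) hxd (projDeriv_mfderiv_section hsx _).symm ?_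
      refine Eq.trans ?_ (fiberDeriv_mfderiv_section hsx _ hxd.1).symm
      rw [hder]
      exact eq_neg_of_add_eq_zero_left hw

/-- `K` is the connector of `∇`: the projection of the tangent spaces of the total space onto the
fibres along the horizontal spaces. -/
structure IsConnector (nabla : CovariantDerivative 𝓘(ℝ, E) F V)
    (K : ∀ v : TotalSpace F V, TangentSpace (𝓘(ℝ, E).prod 𝓘(ℝ, F)) v →ₗ[ℝ] V v.proj) : Prop where
  horizontalSpace_eq : ∀ v, horizontalSpace 𝓘(ℝ, E) F nabla v = LinearMap.ker (K v)
  map_verticalLift : ∀ v u, K v (verticalLift 𝓘(ℝ, E) F v u) = u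
  exists_connectionForm : ∀ x₀, ∃ U G, IsConnectionForm nabla x₀ U G ∧
    ∀ v : TotalSpace F V, v.proj ∈ U → ∀ w,
      fiberCoord F V x₀ v.proj (K v w) = localConnector x₀ G v w

theorem exists_isConnector [T2Space M] [FiniteDimensional ℂ F]
    (nabla : CovariantDerivative 𝓘(ℝ, E) F V) [nabla.ContMDiffCovariantDerivative ∞] :
    ∃ K, IsConnector nabla K := by
  choose U G h using exists_isConnectionForm nabla
  let K : ∀ v : TotalSpace F V, TangentSpace (𝓘(ℝ, E).prod 𝓘(ℝ, F)) v →ₗ[ℝ] V v.proj := fun v ↦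
    ((trivializationAt F V v.proj).symmL ℝ v.proj).toLinearMap ∘ₗ
      (localConnector v.proj (G v.proj) v).toLinearMap
  have hb : ∀ x : M, x ∈ (trivializationAt F V x).baseSet := mem_baseSet_trivializationAt F V
  have hK : ∀ v w, fiberCoord F V v.proj v.proj (K v w) =
      localConnector v.proj (G v.proj) v w := fun v w ↦
    (trivializationAt F V v.proj).continuousLinearMapAt_symmL (hb v.proj) _
  have hker : ∀ v, horizontalSpace 𝓘(ℝ, E) F nabla v = LinearMap.ker (K v) := by
    intro v
    rw [(h v.proj).horizontalSpace_eq (h v.proj).mem]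
    ext w
    change localConnector v.proj (G v.proj) v w = 0 ↔ K v w = 0
    rw [← hK, map_eq_zero_iff _ (fiberCoord_bijective (hb v.proj)).1]
  have hlift : ∀ v u, K v (verticalLift 𝓘(ℝ, E) F v u) = u := fun v u ↦
    (fiberCoord_bijective (hb v.proj)).1 ((hK v _).trans (localConnector_verticalLift _ (hb _) u))
  refine ⟨K, hker, hlift, fun x₀ ↦ ⟨U x₀, G x₀, h x₀, fun v hv w ↦ ?_⟩⟩
  have hw : w - verticalLift 𝓘(ℝ, E) F v (K v w) ∈
      LinearMap.ker (localConnector x₀ (G x₀) v).toLinearMap := by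
    rw [← (h x₀).horizontalSpace_eq hv, hker, LinearMap.mem_ker, map_sub, hlift, sub_self]
  have := (map_sub (localConnector x₀ (G x₀) v) _ _).symm.trans hw
  rw [localConnector_verticalLift _ ((h x₀).subset hv).1] at this
  exact (sub_eq_zero.1 this).symm

/-! ### Local extension of the complex structure of the base -/

theorem AlmostCRStructure.mem_levi_of_span {d : ℕ} (S : AlmostCRStructure 𝓘(ℝ, E) M d) {r : ℕ}
    {X : Fin r → ∀ x : M, TangentSpace 𝓘(ℝ, E) x} {x : M}
    (h : Submodule.span ℝ (Set.range fun i ↦ X i x) = S.levi x) (i : Fin r) :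
    X i x ∈ S.levi x :=
  h ▸ Submodule.subset_span ⟨i, rfl⟩

/-- In coordinates, `J` is locally the restriction of a smooth family of endomorphisms of the model
space. -/
theorem AlmostCRStructure.exists_local_extension {d : ℕ} (S : AlmostCRStructure 𝓘(ℝ, E) M d)
    (x₀ : M) : ∃ A : M → E →L[ℝ] E, ContMDiffAt 𝓘(ℝ, E) 𝓘(ℝ, E →L[ℝ] E) ∞ A x₀ ∧
      ∀ᶠ x in 𝓝 x₀, ∀ w : S.levi x,
        tangentCoord x₀ x (S.J x w : TangentSpace 𝓘(ℝ, E) x) =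
          A x (tangentCoord x₀ x (w : TangentSpace 𝓘(ℝ, E) x)) := by
  classical
  have : CompleteSpace E := FiniteDimensional.complete ℝ E
  obtain ⟨U, hU, hxU, r, X, hX, hXs⟩ := S.exists_local_frame x₀
  let Y : Fin r → ∀ x : M, S.levi x := fun i x ↦
    if h : X i x ∈ S.levi x then ⟨X i x, h⟩ else 0
  have hYX : ∀ x ∈ U, ∀ i, (Y i x : TangentSpace 𝓘(ℝ, E) x) = X i x := fun x hx i ↦ by
    simp only [Y, dif_pos (S.mem_levi_of_span (hXs x hx).2 i)]
  have hJY := fun i ↦ S.contMDiffOn_J U hU (Y i) ((hX i).congr fun x hx ↦ by rw [hYX x hx])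
  let f : Fin r → M → E := fun i x ↦ tangentCoord x₀ x (X i x)
  let g : Fin r → M → E := fun i x ↦ tangentCoord x₀ x (S.J x (Y i x) : TangentSpace 𝓘(ℝ, E) x)
  have hf : ∀ i, ContMDiffAt 𝓘(ℝ, E) 𝓘(ℝ, E) ∞ (f i) x₀ := fun i ↦
    (contMDiffAt_vectorField_base_iff (mem_chart_source E x₀)).1
      ((hX i).contMDiffAt (hU.mem_nhds hxU))
  have hg : ∀ i, ContMDiffAt 𝓘(ℝ, E) 𝓘(ℝ, E) ∞ (g i) x₀ := fun i ↦
    (contMDiffAt_vectorField_base_iff (mem_chart_source E x₀)).1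
      ((hJY i).contMDiffAt (hU.mem_nhds hxU))
  let T : (Fin r → M → E) → M → (Fin r → ℝ) →L[ℝ] E := fun f x ↦
    ∑ i, ContinuousLinearMap.smulRightL ℝ (Fin r → ℝ) E (ContinuousLinearMap.proj i) (f i x)
  have hTapp : ∀ f x c, T f x c = ∑ i, c i • f i x := fun f x c ↦ by simp [T]
  have hT : ∀ f : Fin r → M → E, (∀ i, ContMDiffAt 𝓘(ℝ, E) 𝓘(ℝ, E) ∞ (f i) x₀) →
      ContMDiffAt 𝓘(ℝ, E) 𝓘(ℝ, (Fin r → ℝ) →L[ℝ] E) ∞ (T f) x₀ := fun f hf ↦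
    contMDiffAt_finsetSum fun i _ ↦ contMDiffAt_const.clm_apply (hf i)
  have hinj : Function.Injective (T f x₀) := by
    refine (injective_iff_map_eq_zero _).2 fun c hc ↦ ?_
    have h0 : ∑ i, c i • X i x₀ = 0 := by
      apply (tangentCoord_bijective (mem_chart_source E x₀)).1
      rw [map_sum, map_zero]
      simp only [map_smul]
      exact (hTapp f x₀ c).symm.trans hc
    exact funext (Fintype.linearIndependent_iff.1 (hXs x₀ hxU).1 c h0)
  obtain ⟨P', hP'⟩ := (T f x₀).toLinearMap.exists_leftInverse_of_injective
    (LinearMap.ker_eq_bot.2 hinj)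
  let P : E →L[ℝ] (Fin r → ℝ) := LinearMap.toContinuousLinearMap P'
  have hQ : ContMDiffAt 𝓘(ℝ, E) 𝓘(ℝ, (Fin r → ℝ) →L[ℝ] (Fin r → ℝ)) ∞
    (fun x ↦ P.comp (T f x)) x₀ := contMDiffAt_const.clm_comp (hT f hf)
  have hQ0 : P.comp (T f x₀) = (ContinuousLinearEquiv.refl ℝ (Fin r → ℝ) :
      (Fin r → ℝ) →L[ℝ] (Fin r → ℝ)) := by
    ext1 c
    exact LinearMap.congr_fun hP' c
  have hinv : ContMDiffAt 𝓘(ℝ, E) 𝓘(ℝ, (Fin r → ℝ) →L[ℝ] (Fin r → ℝ)) ∞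
      (fun x ↦ ContinuousLinearMap.inverse (P.comp (T f x))) x₀ := by
    have := contDiffAt_map_inverse (n := ∞) (ContinuousLinearEquiv.refl ℝ (Fin r → ℝ))
    rw [← hQ0] at this
    exact this.contMDiffAt.comp x₀ hQ
  refine ⟨fun x ↦ (T g x).comp ((ContinuousLinearMap.inverse (P.comp (T f x))).comp P),
    (hT g hg).clm_comp (hinv.clm_comp contMDiffAt_const), ?_⟩
  have hnear : ∀ᶠ x in 𝓝 x₀, (P.comp (T f x)).IsInvertible :=
    hQ.continuousAt.eventually (p := ContinuousLinearMap.IsInvertible) (by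
      change ∀ᶠ y in 𝓝 (P.comp (T f x₀)), _
      rw [hQ0]
      exact ContinuousLinearEquiv.nhds _)
  filter_upwards [hnear, hU.mem_nhds hxU] with x hx hxU w
  have hwspan : (w : TangentSpace 𝓘(ℝ, E) x) ∈ Submodule.span ℝ (Set.range fun i ↦ X i x) := by
    rw [(hXs x hxU).2]
    exact w.2
  obtain ⟨c, hc⟩ := (Submodule.mem_span_range_iff_exists_fun ℝ).1 hwspan
  have hw : w = ∑ i, c i • Y i x := by
    apply Subtype.ext
    simp only [← hc, Submodule.coe_sum, Submodule.coe_smul, hYX x hxU]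
  have h₁ : tangentCoord x₀ x (w : TangentSpace 𝓘(ℝ, E) x) = T f x c := by
    rw [← hc, map_sum, hTapp]
    simp only [map_smul, f]
  have h₂ : tangentCoord x₀ x (S.J x w : TangentSpace 𝓘(ℝ, E) x) = T g x c := by
    rw [hw, map_sum, hTapp, Submodule.coe_sum, map_sum]
    simp only [map_smul, Submodule.coe_smul, g]
  rw [h₁, h₂]
  change _ = T g x (ContinuousLinearMap.inverse (P.comp (T f x)) ((P.comp (T f x)) c))
  rw [hx.inverse_apply_self]

/-! ### The almost CR structure on the total space -/

/-- The preimage of the Levi distribution under the projection of the bundle. -/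
def liftedLevi {d : ℕ} (S : AlmostCRStructure 𝓘(ℝ, E) M d) (v : TotalSpace F V) :
    Submodule ℝ (TangentSpace (𝓘(ℝ, E).prod 𝓘(ℝ, F)) v) :=
  (S.levi v.proj).comap (projDeriv 𝓘(ℝ, E) F v).toLinearMap

theorem projDeriv_surjective (v : TotalSpace F V) :
    Function.Surjective (projDeriv 𝓘(ℝ, E) F v) := fun X ↦ by
  obtain ⟨w, hw, -⟩ := coord_surjective (mem_coordDomain_self v.proj) X (0 : F)
  exact ⟨w, hw⟩

theorem finrank_liftedLevi_add [FiniteDimensional ℂ F] {d : ℕ}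
    (S : AlmostCRStructure 𝓘(ℝ, E) M d) (v : TotalSpace F V) :
    finrank ℝ (liftedLevi S v) + d =
      finrank ℝ (TangentSpace (𝓘(ℝ, E).prod 𝓘(ℝ, F)) v) := by
  have : FiniteDimensional ℝ (TangentSpace 𝓘(ℝ, E) v.proj) :=
    inferInstanceAs (FiniteDimensional ℝ E)
  have : FiniteDimensional ℝ (TangentSpace (𝓘(ℝ, E).prod 𝓘(ℝ, F)) v) :=
    inferInstanceAs (FiniteDimensional ℝ (E × F))
  have h₁ := (S.levi v.proj).finrank_quotient_add_finrank
  have h₂ := S.finrank_levi_add v.proj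
  have h₃ := LinearMap.finrank_range_add_finrank_ker
    ((S.levi v.proj).mkQ ∘ₗ (projDeriv 𝓘(ℝ, E) F v).toLinearMap)
  have h₄ : Function.Surjective
      ((S.levi v.proj).mkQ ∘ₗ (projDeriv 𝓘(ℝ, E) F v).toLinearMap) :=
    (S.levi v.proj).mkQ_surjective.comp (projDeriv_surjective (E := E) v)
  rw [LinearMap.range_eq_top.2 h₄, finrank_top, LinearMap.ker_comp, Submodule.ker_mkQ] at h₃
  change _ + finrank ℝ (liftedLevi S v) = _ at h₃
  omega

theorem exists_vectorField (x₀ : M) (Y : ∀ v : TotalSpace F V, TangentSpace 𝓘(ℝ, E) v.proj)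
    (f : TotalSpace F V → F) :
    ∃ W : ∀ v : TotalSpace F V, TangentSpace (𝓘(ℝ, E).prod 𝓘(ℝ, F)) v,
      ∀ v, v.proj ∈ coordDomain E F V x₀ →
        projDeriv 𝓘(ℝ, E) F v (W v) = Y v ∧ fiberDeriv x₀ v (W v) = f v := by
  classical
  refine ⟨fun v ↦ if h : v.proj ∈ coordDomain E F V x₀ then
    (coord_surjective h (Y v) (f v)).choose else 0, fun v h ↦ ?_⟩
  simp only [dif_pos h]
  exact (coord_surjective h (Y v) (f v)).choose_spec

theorem exists_local_frame_liftedLevi [FiniteDimensional ℂ F] {d : ℕ}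
    (S : AlmostCRStructure 𝓘(ℝ, E) M d) (v₀ : TotalSpace F V) :
    ∃ U : Set (TotalSpace F V), IsOpen U ∧ v₀ ∈ U ∧
    ∃ (r : ℕ) (X : Fin r → ∀ v : TotalSpace F V, TangentSpace (𝓘(ℝ, E).prod 𝓘(ℝ, F)) v),
      (∀ i, ContMDiffOn (𝓘(ℝ, E).prod 𝓘(ℝ, F)) (𝓘(ℝ, E).prod 𝓘(ℝ, F)).tangent ∞
        (fun v ↦ (⟨v, X i v⟩ : TangentBundle (𝓘(ℝ, E).prod 𝓘(ℝ, F)) (TotalSpace F V))) U) ∧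
      ∀ v ∈ U, LinearIndependent ℝ (fun i ↦ X i v) ∧
        Submodule.span ℝ (Set.range fun i ↦ X i v) = liftedLevi S v := by
  obtain ⟨U, hU, hxU, r, X, hX, hXs⟩ := S.exists_local_frame v₀.proj
  set x₀ := v₀.proj with hx₀
  let b := Module.finBasis ℝ F
  choose W₁ hW₁ using fun i ↦ exists_vectorField (F := F) (V := V) x₀ (fun v ↦ X i v.proj) 0
  choose W₂ hW₂ using fun j ↦ exists_vectorField (E := E) (V := V) x₀ 0
    (fun _ ↦ b j)
  let W : (Fin r ⊕ Fin (finrank ℝ F)) →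
      ∀ v : TotalSpace F V, TangentSpace (𝓘(ℝ, E).prod 𝓘(ℝ, F)) v := Sum.elim W₁ W₂
  have hUo : IsOpen (π F V ⁻¹' (U ∩ coordDomain E F V x₀)) :=
    (hU.inter (isOpen_coordDomain x₀)).preimage (FiberBundle.continuous_proj F V)
  have hWs : ∀ k, ContMDiffOn (𝓘(ℝ, E).prod 𝓘(ℝ, F)) (𝓘(ℝ, E).prod 𝓘(ℝ, F)).tangent ∞
      (fun v ↦ (⟨v, W k v⟩ : TangentBundle (𝓘(ℝ, E).prod 𝓘(ℝ, F)) (TotalSpace F V)))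
      (π F V ⁻¹' (U ∩ coordDomain E F V x₀)) := by
    intro k v hv
    refine ((contMDiffAt_vectorField_iff hv.2).2 ?_).contMDiffWithinAt
    rcases k with i | j
    · constructor
      · have h₁ : ContMDiffAt 𝓘(ℝ, E) 𝓘(ℝ, E) ∞ (fun x ↦ tangentCoord x₀ x (X i x)) v.proj :=
          (contMDiffAt_vectorField_base_iff hv.2.2).1 ((hX i).contMDiffAt (hU.mem_nhds hv.1))
        refine (h₁.comp v (contMDiffAt_proj V)).congr_of_eventuallyEq ?_
        filter_upwards [hUo.mem_nhds hv] with y hy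
        exact congrArg (tangentCoord x₀ y.proj) (hW₁ i y hy.2).1
      · refine (contMDiffAt_const (c := (0 : F))).congr_of_eventuallyEq ?_
        filter_upwards [hUo.mem_nhds hv] with y hy
        exact (hW₁ i y hy.2).2
    · constructor
      · refine (contMDiffAt_const (c := (0 : E))).congr_of_eventuallyEq ?_
        filter_upwards [hUo.mem_nhds hv] with y hy
        exact (congrArg (tangentCoord x₀ y.proj) (hW₂ j y hy.2).1).trans (map_zero _)
      · refine (contMDiffAt_const (c := b j)).congr_of_eventuallyEq ?_
        filter_upwards [hUo.mem_nhds hv] with y hy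
        exact (hW₂ j y hy.2).2
  refine ⟨_, hUo, ⟨hxU, mem_coordDomain_self x₀⟩, r + finrank ℝ F,
    fun k ↦ W (finSumFinEquiv.symm k), fun k ↦ hWs _, fun v hv ↦ ⟨?_, ?_⟩⟩
  · refine (linearIndependent_equiv (finSumFinEquiv.symm) (f := fun k ↦ W k v)).2 ?_
    refine LinearIndependent.of_comp
      ((projDeriv 𝓘(ℝ, E) F v).toLinearMap.prod (fiberDeriv x₀ v).toLinearMap) ?_
    have := linearIndependent_inl_union_inr' (hXs v.proj hv.1).1 b.linearIndependent
    convert this using 1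
    ext1 k
    rcases k with i | j
    · exact Prod.ext (hW₁ i v hv.2).1 (hW₁ i v hv.2).2
    · exact Prod.ext (hW₂ j v hv.2).1 (hW₂ j v hv.2).2
  · have hr : (Set.range fun k ↦ W (finSumFinEquiv.symm k) v) = Set.range fun k ↦ W k v :=
      finSumFinEquiv.symm.surjective.range_comp (fun k ↦ W k v)
    rw [hr]
    apply le_antisymm
    · refine Submodule.span_le.2 ?_
      rintro _ ⟨i | j, rfl⟩
      · change projDeriv 𝓘(ℝ, E) F v (W₁ i v) ∈ S.levi v.proj
        rw [(hW₁ i v hv.2).1]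
        exact S.mem_levi_of_span (hXs v.proj hv.1).2 i
      · change projDeriv 𝓘(ℝ, E) F v (W₂ j v) ∈ S.levi v.proj
        rw [(hW₂ j v hv.2).1]
        exact zero_mem _
    · intro w hw
      have hw' : projDeriv 𝓘(ℝ, E) F v w ∈
          Submodule.span ℝ (Set.range fun i ↦ X i v.proj) := by
        rw [(hXs v.proj hv.1).2]
        exact hw
      obtain ⟨c, hc⟩ := (Submodule.mem_span_range_iff_exists_fun ℝ).1 hw'
      have : w = ∑ i, c i • W₁ i v + ∑ j, b.repr (fiberDeriv x₀ v w) j • W₂ j v := by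
        apply coord_injective hv.2
        · simp only [map_add, map_sum, map_smul, (hW₁ _ v hv.2).1, (hW₂ _ v hv.2).1]
          simp [hc]
        · simp only [map_add, map_sum, map_smul, (hW₁ _ v hv.2).2, (hW₂ _ v hv.2).2]
          simp [b.sum_repr]
      rw [this]
      exact add_mem
        (sum_mem fun i _ ↦ Submodule.smul_mem _ _ (Submodule.subset_span ⟨Sum.inl i, rfl⟩))
        (sum_mem fun j _ ↦ Submodule.smul_mem _ _ (Submodule.subset_span ⟨Sum.inr j, rfl⟩))

namespace IsConnector

variable {nabla : CovariantDerivative 𝓘(ℝ, E) F V}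
  {K : ∀ v : TotalSpace F V, TangentSpace (𝓘(ℝ, E).prod 𝓘(ℝ, F)) v →ₗ[ℝ] V v.proj}

theorem bijective (hK : IsConnector nabla K) (v : TotalSpace F V) :
    Function.Bijective ((projDeriv 𝓘(ℝ, E) F v).toLinearMap.prod (K v)) := by
  constructor
  · refine (injective_iff_map_eq_zero _).2 fun w hw ↦ ?_
    have h₁ : projDeriv 𝓘(ℝ, E) F v w = 0 := (Prod.ext_iff.1 hw).1
    have h₂ : K v w = 0 := (Prod.ext_iff.1 hw).2
    obtain ⟨U, G, hG, h⟩ := hK.exists_connectionForm v.proj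
    have h₃ := h v hG.mem w
    rw [h₂, localConnector_apply, h₁] at h₃
    refine coord_injective (mem_coordDomain_self v.proj) (by rw [h₁, map_zero]) ?_
    simpa using h₃.symm
  · rintro ⟨X, u⟩
    obtain ⟨w, hw⟩ := projDeriv_surjective v X
    refine ⟨w + verticalLift 𝓘(ℝ, E) F v (u - K v w), Prod.ext ?_ ?_⟩
    · refine (map_add (projDeriv 𝓘(ℝ, E) F v) _ _).trans ?_
      rw [hw, projDeriv_verticalLift, add_zero]
    · refine (map_add (K v) _ _).trans ?_
      rw [hK.map_verticalLift, add_sub_cancel]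

/-- The splitting of the tangent spaces of the total space into horizontal and vertical parts. -/
def splitting (hK : IsConnector nabla K) (v : TotalSpace F V) :
    TangentSpace (𝓘(ℝ, E).prod 𝓘(ℝ, F)) v ≃ₗ[ℝ] TangentSpace 𝓘(ℝ, E) v.proj × V v.proj :=
  LinearEquiv.ofBijective _ (hK.bijective v)

theorem ext (hK : IsConnector nabla K) {v : TotalSpace F V}
    {w w' : TangentSpace (𝓘(ℝ, E).prod 𝓘(ℝ, F)) v}
    (h₁ : projDeriv 𝓘(ℝ, E) F v w = projDeriv 𝓘(ℝ, E) F v w') (h₂ : K v w = K v w') : w = w' :=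
  (hK.bijective v).1 (Prod.ext h₁ h₂)

theorem projDeriv_splitting_symm (hK : IsConnector nabla K) (v : TotalSpace F V)
    (p : TangentSpace 𝓘(ℝ, E) v.proj × V v.proj) :
    projDeriv 𝓘(ℝ, E) F v ((hK.splitting v).symm p) = p.1 :=
  congrArg Prod.fst ((hK.splitting v).apply_symm_apply p)

theorem connector_splitting_symm (hK : IsConnector nabla K) (v : TotalSpace F V)
    (p : TangentSpace 𝓘(ℝ, E) v.proj × V v.proj) : K v ((hK.splitting v).symm p) = p.2 :=
  congrArg Prod.snd ((hK.splitting v).apply_symm_apply p)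

theorem mem_horizontalSpace_iff (hK : IsConnector nabla K) {v : TotalSpace F V}
    {w : TangentSpace (𝓘(ℝ, E).prod 𝓘(ℝ, F)) v} :
    w ∈ horizontalSpace 𝓘(ℝ, E) F nabla v ↔ K v w = 0 := by
  rw [hK.horizontalSpace_eq, LinearMap.mem_ker]

theorem exists_eq_add (hK : IsConnector nabla K) (v : TotalSpace F V)
    (w : TangentSpace (𝓘(ℝ, E).prod 𝓘(ℝ, F)) v) :
    ∃ h ∈ horizontalSpace 𝓘(ℝ, E) F nabla v, projDeriv 𝓘(ℝ, E) F v h = projDeriv 𝓘(ℝ, E) F v w ∧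
      ∃ u ∈ verticalSpace 𝓘(ℝ, E) F v, h + u = w := by
  refine ⟨(hK.splitting v).symm (projDeriv 𝓘(ℝ, E) F v w, 0),
    hK.mem_horizontalSpace_iff.2 (hK.connector_splitting_symm v _),
    hK.projDeriv_splitting_symm v _, (hK.splitting v).symm (0, K v w),
    hK.projDeriv_splitting_symm v _, hK.ext ?_ ?_⟩
  · rw [map_add, projDeriv_splitting_symm, projDeriv_splitting_symm, add_zero]
  · rw [map_add, connector_splitting_symm, connector_splitting_symm, zero_add]

theorem isCompl (hK : IsConnector nabla K) (v : TotalSpace F V) :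
    IsCompl (horizontalSpace 𝓘(ℝ, E) F nabla v) (verticalSpace 𝓘(ℝ, E) F v) := by
  constructor
  · refine Submodule.disjoint_def.2 fun w hw hw' ↦ hK.ext ?_ ?_
    · rw [map_zero]
      exact hw'
    · rw [map_zero, hK.mem_horizontalSpace_iff.1 hw]
  · refine codisjoint_iff.2 (eq_top_iff.2 fun w _ ↦ ?_)
    obtain ⟨h, hh, -, u, hu, rfl⟩ := hK.exists_eq_add v w
    exact Submodule.add_mem_sup hh hu

variable {d : ℕ} (S : AlmostCRStructure 𝓘(ℝ, E) M d)

theorem liftedLevi_eq (hK : IsConnector nabla K) (v : TotalSpace F V) :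
    liftedLevi S v = (horizontalSpace 𝓘(ℝ, E) F nabla v ⊓
      (S.levi v.proj).comap (projDeriv 𝓘(ℝ, E) F v).toLinearMap) ⊔
        verticalSpace 𝓘(ℝ, E) F v := by
  apply le_antisymm
  · intro w hw
    obtain ⟨h, hh, hhw, u, hu, rfl⟩ := hK.exists_eq_add v w
    refine Submodule.add_mem_sup ⟨hh, ?_⟩ hu
    change projDeriv 𝓘(ℝ, E) F v h ∈ S.levi v.proj
    rw [hhw]
    exact hw
  · refine sup_le inf_le_right fun w hw ↦ ?_
    have hw' : projDeriv 𝓘(ℝ, E) F v w = 0 := hw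
    change projDeriv 𝓘(ℝ, E) F v w ∈ S.levi v.proj
    rw [hw']
    exact zero_mem _

/-- The complex structure on the lifted Levi distribution: `J` on horizontal vectors and
multiplication by `i` on vertical vectors. -/
def liftedJ (hK : IsConnector nabla K) (v : TotalSpace F V) :
    liftedLevi S v →ₗ[ℝ] liftedLevi S v :=
  LinearMap.codRestrict _
    ((hK.splitting v).symm.toLinearMap ∘ₗ LinearMap.prod
      ((S.levi v.proj).subtype ∘ₗ S.J v.proj ∘ₗ
        (projDeriv 𝓘(ℝ, E) F v).toLinearMap.restrict (p := liftedLevi S v) fun _ h ↦ h)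
      ((Complex.I • LinearMap.id : V v.proj →ₗ[ℝ] V v.proj) ∘ₗ K v ∘ₗ (liftedLevi S v).subtype))
    fun w ↦ by
      change projDeriv 𝓘(ℝ, E) F v ((hK.splitting v).symm _) ∈ S.levi v.proj
      rw [projDeriv_splitting_symm]
      exact (S.J v.proj _).2

theorem projDeriv_liftedJ (hK : IsConnector nabla K) (v : TotalSpace F V) (w : liftedLevi S v) :
    projDeriv 𝓘(ℝ, E) F v (hK.liftedJ S v w : TangentSpace (𝓘(ℝ, E).prod 𝓘(ℝ, F)) v) =
      (S.J v.proj ⟨projDeriv 𝓘(ℝ, E) F v w, w.2⟩ : TangentSpace 𝓘(ℝ, E) v.proj) :=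
  hK.projDeriv_splitting_symm v _

theorem connector_liftedJ (hK : IsConnector nabla K) (v : TotalSpace F V) (w : liftedLevi S v) :
    K v (hK.liftedJ S v w : TangentSpace (𝓘(ℝ, E).prod 𝓘(ℝ, F)) v) = Complex.I • K v w :=
  hK.connector_splitting_symm v _

theorem liftedJ_liftedJ (hK : IsConnector nabla K) (v : TotalSpace F V) (w : liftedLevi S v) :
    hK.liftedJ S v (hK.liftedJ S v w) = -w := by
  apply Subtype.ext
  apply hK.ext
  · rw [projDeriv_liftedJ]
    have : (⟨projDeriv 𝓘(ℝ, E) F v (hK.liftedJ S v w), (hK.liftedJ S v w).2⟩ : S.levi v.proj) =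
        S.J v.proj ⟨projDeriv 𝓘(ℝ, E) F v w, w.2⟩ :=
      Subtype.ext (hK.projDeriv_liftedJ S v w)
    rw [this, S.J_J]
    exact (map_neg (projDeriv 𝓘(ℝ, E) F v) _).symm
  · rw [connector_liftedJ, connector_liftedJ, smul_smul, Complex.I_mul_I, neg_one_smul]
    exact (map_neg (K v) _).symm

theorem contMDiffOn_liftedJ (hK : IsConnector nabla K) (U : Set (TotalSpace F V)) (hU : IsOpen U)
    (W : ∀ v : TotalSpace F V, liftedLevi S v)
    (hW : ContMDiffOn (𝓘(ℝ, E).prod 𝓘(ℝ, F)) (𝓘(ℝ, E).prod 𝓘(ℝ, F)).tangent ∞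
      (fun v ↦ (⟨v, (W v : TangentSpace (𝓘(ℝ, E).prod 𝓘(ℝ, F)) v)⟩ :
        TangentBundle (𝓘(ℝ, E).prod 𝓘(ℝ, F)) (TotalSpace F V))) U) :
    ContMDiffOn (𝓘(ℝ, E).prod 𝓘(ℝ, F)) (𝓘(ℝ, E).prod 𝓘(ℝ, F)).tangent ∞
      (fun v ↦ (⟨v, (hK.liftedJ S v (W v) : TangentSpace (𝓘(ℝ, E).prod 𝓘(ℝ, F)) v)⟩ :
        TangentBundle (𝓘(ℝ, E).prod 𝓘(ℝ, F)) (TotalSpace F V))) U := by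
  intro v₀ hv₀
  have hd := mem_coordDomain_self (E := E) (F := F) (V := V) v₀.proj
  obtain ⟨A, hA, hAJ⟩ := S.exists_local_extension v₀.proj
  obtain ⟨U', G, hG, hGK⟩ := hK.exists_connectionForm v₀.proj
  set x₀ := v₀.proj with hx₀
  obtain ⟨ha, hb⟩ := (contMDiffAt_vectorField_iff hd).1 (hW.contMDiffAt (hU.mem_nhds hv₀))
  refine ((contMDiffAt_vectorField_iff hd).2 ?_).contMDiffWithinAt
  have hproj : ContMDiffAt (𝓘(ℝ, E).prod 𝓘(ℝ, F)) 𝓘(ℝ, E) ∞ (π F V) v₀ := contMDiffAt_proj V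
  have hA' : ContMDiffAt (𝓘(ℝ, E).prod 𝓘(ℝ, F)) 𝓘(ℝ, E →L[ℝ] E) ∞ (fun v ↦ A v.proj) v₀ :=
    ContMDiffAt.comp v₀ hA hproj
  have hG' : ContMDiffAt (𝓘(ℝ, E).prod 𝓘(ℝ, F)) 𝓘(ℝ, E →L[ℝ] F →L[ℝ] F) ∞
    (fun v ↦ G v.proj) v₀ := ContMDiffAt.comp v₀ hG.contMDiffAt hproj
  have hφ := contMDiffAt_fiberComponent (E := E) x₀ hd.1
  have hAa := hA'.clm_apply ha
  have hev : ∀ᶠ v : TotalSpace F V in 𝓝 v₀,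
      tangentCoord x₀ v.proj (projDeriv 𝓘(ℝ, E) F v (hK.liftedJ S v (W v))) =
        A v.proj (tangentCoord x₀ v.proj (projDeriv 𝓘(ℝ, E) F v (W v))) := by
    filter_upwards [hproj.continuousAt.eventually hAJ] with v hv
    rw [projDeriv_liftedJ]
    exact hv _
  refine ⟨hAa.congr_of_eventuallyEq hev, ?_⟩
  let m : F →L[ℝ] F := Complex.I • ContinuousLinearMap.id ℝ F
  have hm : ContMDiffAt (𝓘(ℝ, E).prod 𝓘(ℝ, F)) 𝓘(ℝ, F →L[ℝ] F) ∞
    (fun _ : TotalSpace F V ↦ m) v₀ := contMDiffAt_const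
  refine ((hm.clm_apply (hb.add ((hG'.clm_apply ha).clm_apply hφ))).sub
    ((hG'.clm_apply hAa).clm_apply hφ)).congr_of_eventuallyEq ?_
  filter_upwards [hev, hproj.continuousAt.preimage_mem_nhds (hG.isOpen.mem_nhds hG.mem)] with v hv hvU
  have hvd := hG.subset hvU
  have h₁ := hGK v hvU (hK.liftedJ S v (W v))
  rw [connector_liftedJ, fiberCoord_smul hvd.1, hGK v hvU, localConnector_apply,
    localConnector_apply, hv] at h₁
  refine (eq_sub_of_add_eq h₁.symm).trans ?_
  rw [fiberCoord_apply hvd.1 v.snd]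
  rfl

/-- The almost CR structure on the total space of a complex vector bundle that is induced by a
linear connection and an almost CR structure on the base. -/
def almostCRStructure [FiniteDimensional ℂ F] (hK : IsConnector nabla K) :
    AlmostCRStructure (𝓘(ℝ, E).prod 𝓘(ℝ, F)) (TotalSpace F V) d where
  levi := liftedLevi S
  finrank_levi_add := finrank_liftedLevi_add S
  exists_local_frame := exists_local_frame_liftedLevi S
  J := hK.liftedJ S
  J_J := hK.liftedJ_liftedJ S
  contMDiffOn_J := hK.contMDiffOn_liftedJ S

end IsConnector

end

theorem proposition1p4
    {E : Type*} [NormedAddCommGroup E] [NormedSpace ℝ E] [FiniteDimensional ℝ E]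
    {M : Type*} [TopologicalSpace M] [T2Space M] [ChartedSpace E M] [IsManifold 𝓘(ℝ, E) ∞ M]
    {F : Type*} [NormedAddCommGroup F] [NormedSpace ℂ F] [FiniteDimensional ℂ F]
    {V : M → Type*} [TopologicalSpace (TotalSpace F V)]
    [∀ x, AddCommGroup (V x)] [∀ x, Module ℂ (V x)] [∀ x, TopologicalSpace (V x)]
    [∀ x, IsTopologicalAddGroup (V x)] [∀ x, ContinuousSMul ℝ (V x)]
    [FiberBundle F V] [VectorBundle ℂ F V] [ContMDiffVectorBundle ∞ F V 𝓘(ℝ, E)]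
    {d : ℕ} (S : AlmostCRStructure 𝓘(ℝ, E) M d)
    (nabla : CovariantDerivative 𝓘(ℝ, E) F V) [nabla.ContMDiffCovariantDerivative ∞] :
    (∀ v : TotalSpace F V,
      IsCompl (horizontalSpace 𝓘(ℝ, E) F nabla v) (verticalSpace 𝓘(ℝ, E) F v)) ∧
    ∃ T : AlmostCRStructure (𝓘(ℝ, E).prod 𝓘(ℝ, F)) (TotalSpace F V) d,
      IsAlmostCRMap T S (π F V) ∧
      (∀ v : TotalSpace F V,
        T.levi v = (horizontalSpace 𝓘(ℝ, E) F nabla v ⊓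
            (S.levi v.proj).comap (projDeriv 𝓘(ℝ, E) F v).toLinearMap) ⊔
          verticalSpace 𝓘(ℝ, E) F v) ∧
      (∀ (v : TotalSpace F V) (w : T.levi v),
        (w : TangentSpace (𝓘(ℝ, E).prod 𝓘(ℝ, F)) v) ∈ horizontalSpace 𝓘(ℝ, E) F nabla v →
        (T.J v w : TangentSpace (𝓘(ℝ, E).prod 𝓘(ℝ, F)) v) ∈
            horizontalSpace 𝓘(ℝ, E) F nabla v ∧
          ∃ h : projDeriv 𝓘(ℝ, E) F v w ∈ S.levi v.proj,
            projDeriv 𝓘(ℝ, E) F v (T.J v w) = S.J v.proj ⟨_, h⟩) ∧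
      (∀ (v : TotalSpace F V) (u : V v.proj),
        ∃ h : verticalLift 𝓘(ℝ, E) F v u ∈ T.levi v,
          T.J v ⟨_, h⟩ = verticalLift 𝓘(ℝ, E) F v (Complex.I • u)) := by
  obtain ⟨K, hK⟩ := exists_isConnector nabla
  refine ⟨hK.isCompl, hK.almostCRStructure S, ⟨contMDiff_proj V, fun v w ↦
    ⟨w.2, hK.projDeriv_liftedJ S v w⟩⟩, hK.liftedLevi_eq S, fun v w hw ↦
    ⟨hK.mem_horizontalSpace_iff.2 ?_, w.2, hK.projDeriv_liftedJ S v w⟩, fun v u ↦ ?_⟩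
  · refine (hK.connector_liftedJ S v w).trans ?_
    rw [hK.mem_horizontalSpace_iff.1 hw, smul_zero]
  · have hmem : verticalLift 𝓘(ℝ, E) F v u ∈ liftedLevi S v := by
      change projDeriv 𝓘(ℝ, E) F v _ ∈ S.levi v.proj
      rw [projDeriv_verticalLift]
      exact zero_mem _
    refine ⟨hmem, hK.ext ?_ ?_⟩
    · refine (hK.projDeriv_liftedJ S v ⟨_, hmem⟩).trans ?_
      have h0 : (⟨projDeriv 𝓘(ℝ, E) F v (verticalLift 𝓘(ℝ, E) F v u), hmem⟩ :
          S.levi v.proj) = 0 := Subtype.ext (projDeriv_verticalLift v u)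
      refine Eq.trans ?_ (projDeriv_verticalLift v (Complex.I • u)).symm
      change ((S.J v.proj ⟨projDeriv 𝓘(ℝ, E) F v (verticalLift 𝓘(ℝ, E) F v u), hmem⟩ :
        S.levi v.proj) : TangentSpace 𝓘(ℝ, E) v.proj) = 0
      rw [h0, map_zero, Submodule.coe_zero]
    · refine (hK.connector_liftedJ S v ⟨_, hmem⟩).trans ?_
      rw [hK.map_verticalLift, hK.map_verticalLift]
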